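/- \textbf{Conventions.} For $p\in\mathbb N$ let $\mathbb Q_p$ be the set of signed fixed-point numbers $k/2^p$ with $k\in\mathbb Z$, $|k|\le 2^{2p}-1$. Arithmetic in $\mathbb Q_p$ is truncated: after each product and each addition (sums are evaluated from left to right) the result is rounded towards zero to $p$ binary digits behind the point and saturated at $\pm(2^p-2^{-p})$. All computations of the networks below are carried out in $\mathbb Q_p$. A function $f$ on the positive integers is $\mathsf{poly}(n)$ if $f(n)\le c\,n^k$ for some constants $c,k$ and all $n\ge 1$, and it is $O(\log n)$ if $f(n)\le c(\lceil\log_2 n\rceil+1)$ for some constant $c$ and all $n\ge1$. \textbf{Computation graphs.} Let $\Sigma=\{s_1,\dots,s_q\}$, $q\ge 1$, be a finite alphabet. A computation graph $G_n$ with $n$ inputs and $m$ outputs is a finite directed acyclic graph with node set $V_n$ and a finite set $\mathcal F_n$ of local functions $f:\Sigma^{\ell}\to\Sigma$ (the arity $\ell$ may depend on $f$). It has exactly one input node, of in-degree $0$, for each $i\in\{1,\dots,n\}$; every other node is labelled by some $f\in\mathcal F_n$, and its in-neighbours (as many as the arity of $f$) are ordered; and $m$ distinct nodes of out-degree $0$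 are listed as output nodes. For $x\in\Sigma^n$, each node $v$ gets a value $v(x)\in\Sigma$: the $i$-th input node has value $x_i$, a function node has the value of its function at the values of its in-neighbours. $G_n(x)\in\Sigma^m$ is the list of values of the output nodes. The size of $G_n$ is $|V_n|$. \textbf{Assumptions on a family.} A family $\{G_n\}$ has \emph{bounded fan-in} if the in-degrees of all nodes of all $G_n$, $n\ge 1$, are bounded by one constant. Its node functions are \emph{polynomially-efficiently approximable} if there are $p(n)=O(\log n)$ and $w(n)=\mathsf{poly}(n)$ such that for each $n\ge 1$ and each $f:\Sigma^\ell\to\Sigma$ in $\mathcal F_n$ there are matrices $W_1,W_2$ over $\mathbb Q_{p(n)}$, of sizes $w'\times \ell q$ and $q\times w'$ with $w'\le w(n)$, such that for each $x\in\Sigma^\ell$ the vector $\hat y(x)=W_2\,\mathrm{ReLU}(W_1\,\mathrm{emb}(x))$, where $\mathrm{emb}(x)$ is the concatenation of the one-hot encodings of the letters of $x$, satisfies: if $f(x)=s_j$ then for some $\delta>0$, $\hat y_j(x)>1-\delta$ and $\hat y_i(x)<1-\delta$ for all $i\ne j$. \textbf{CoT transformers.} A decoder-only transformer with vocabulary $\Sigma$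 and precision $p$ has an embedding dimension $d$, a word embedding $\Sigma\to\mathbb Q_p^d$, a positional embedding $\mathbb N\to\mathbb Q_p^d$, finitely many layers $(\mathrm{id}+\mathrm{FF})\circ(\mathrm{id}+\mathrm{SA})$, and an output matrix in $\mathbb Q_p^{q\times d}$. Here $\mathrm{SA}$ is causal multi-head self-attention with query, key, value and output matrices over $\mathbb Q_p$ and saturated attention (uniform weights on the positions $j\le i$ of maximal score), and $\mathrm{FF}$ is either a network $z\mapsto W_2\,\mathrm{ReLU}(W_1z)$ or a mixture of such networks in which the expert with the largest gating score $(Sz)_e$ is applied. On a nonempty sequence over $\Sigma$, the next token is the letter $s_j$ maximizing the $j$-th logit at the last position (the first maximizer in case of ties). A decoding step appends the next token to the sequence. The parameter size of the transformer on sequences of length at most $N$ is the number of its scalar parameters, including the positional embeddings of $N$ positions. \textbf{Theorem (CoT for DAGs).} Let $\{G_n\}_{n\in\mathbb N}$ be a family of computation graphs over $\Sigma$, $G_n:\Sigma^n\to\Sigma^{m(n)}$, of size $|V_n|=\mathsf{poly}(n)$, with bounded fan-in and polynomially-efficiently approximable node functions. Then there are functions $p(n)=O(\log n)$ and $P(n)=\mathsf{poly}(n)$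 such that for each $n\ge1$ there are a decoder-only transformer $M_n$ with vocabulary $\Sigma$, precision $p(n)$ and parameter size at most $P(n)$ on sequences of length at most $n+|V_n|$, and a topological ordering $v_1,\dots,v_{|V_n|}$ of the nodes of $G_n$ that ends with the output nodes in their order, with the following property. For each $x\in\Sigma^n$, started on the sequence $x$, after $|V_n|$ decoding steps $M_n$ has produced the sequence $$(x_1,\dots,x_n,\,v_1(x),\dots,v_{|V_n|}(x)),$$ that is, it generates the node values in topological order, and the last $m(n)$ tokens of this sequence are $G_n(x)$. -/

import Mathlib

/-! ## Growth rates -/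

/-- `f` grows at most polynomially (input lengths are positive). -/
def IsPolyBounded (f : ℕ → ℕ) : Prop :=
  ∃ k c : ℕ, ∀ n, 1 ≤ n → f n ≤ c * n ^ k

/-- `f n = O(log n)`; the summand `1` only matters at `n = 1`, where `log n = 0`. -/
def IsLogBounded (f : ℕ → ℕ) : Prop :=
  ∃ c : ℕ, ∀ n, 1 ≤ n → f n ≤ c * (Nat.clog 2 n + 1)

/-! ## Fixed-point numbers with truncated arithmetic -/

/-- Signed fixed-point numbers with `p` binary digits before and `p` binary digits after the
binary point: `k / 2 ^ p` for an integer `k` with `|k| ≤ 2 ^ (2 * p) - 1`. -/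
def FixedPoint (p : ℕ) : Type :=
  {r : ℚ // ∃ k : ℤ, |k| ≤ 2 ^ (2 * p) - 1 ∧ r = k / 2 ^ p}

namespace FixedPoint

noncomputable instance (p : ℕ) : LinearOrder (FixedPoint p) :=
  inferInstanceAs (LinearOrder {r : ℚ // ∃ k : ℤ, |k| ≤ 2 ^ (2 * p) - 1 ∧ r = k / 2 ^ p})

/-- The rational number represented by a fixed-point number. -/
def toRat {p : ℕ} (a : FixedPoint p) : ℚ := a.1

/-- Rounding an integer multiple of `2 ^ (-p)` into the representable range (saturation). -/
def clampNum (p : ℕ) (k : ℤ) : ℤ :=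
  max (-(2 ^ (2 * p) - 1)) (min (2 ^ (2 * p) - 1) k)

theorem abs_clampNum_le (p : ℕ) (k : ℤ) : |clampNum p k| ≤ 2 ^ (2 * p) - 1 := by
  have h : (1 : ℤ) ≤ 2 ^ (2 * p) := one_le_pow₀ (by norm_num)
  rw [abs_le]
  refine ⟨le_max_left _ _, max_le (by linarith) (min_le_left _ _)⟩

/-- Truncation of a rational number: drop all binary digits after the `p`-th one behind the
binary point (rounding towards zero), and saturate at the largest representable number. -/
def trunc (p : ℕ) (r : ℚ) : FixedPoint p :=
  ⟨(clampNum p (if 0 ≤ r then ⌊r * 2 ^ p⌋ else ⌈r * 2 ^ p⌉) : ℤ) / 2 ^ p,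
    _, abs_clampNum_le p _, rfl⟩

instance (p : ℕ) : Zero (FixedPoint p) := ⟨trunc p 0⟩
instance (p : ℕ) : One (FixedPoint p) := ⟨trunc p 1⟩
instance (p : ℕ) : Add (FixedPoint p) := ⟨fun a b => trunc p (a.toRat + b.toRat)⟩
instance (p : ℕ) : Mul (FixedPoint p) := ⟨fun a b => trunc p (a.toRat * b.toRat)⟩

/-- Summation from left to right, every partial sum being truncated. -/
def sum {p d : ℕ} (v : Fin d → FixedPoint p) : FixedPoint p :=
  (List.ofFn v).foldl (fun a b => a + b) 0

/-- Inner product, every product and every partial sum being truncated. -/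
def dot {p d : ℕ} (u v : Fin d → FixedPoint p) : FixedPoint p :=
  sum fun j => u j * v j

/-- Matrix-vector product in truncated arithmetic. -/
def matVec {p r d : ℕ} (M : Matrix (Fin r) (Fin d) (FixedPoint p)) (v : Fin d → FixedPoint p) :
    Fin r → FixedPoint p :=
  fun i => dot (M i) v

/-- Coordinatewise `ReLU`. -/
noncomputable def relu {p d : ℕ} (v : Fin d → FixedPoint p) : Fin d → FixedPoint p :=
  fun i => max (v i) 0

/-- Two-layer network without biases: `W₂ ReLU (W₁ v)`. -/
noncomputable def twoLayer {p a w b : ℕ} (W₁ : Matrix (Fin w) (Fin a) (FixedPoint p))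
    (W₂ : Matrix (Fin b) (Fin w) (FixedPoint p)) (v : Fin a → FixedPoint p) :
    Fin b → FixedPoint p :=
  matVec W₂ (relu (matVec W₁ v))

theorem maximizers_nonempty {p d : ℕ} [NeZero d] (z : Fin d → FixedPoint p) :
    (Finset.univ.filter fun i => ∀ j, z j ≤ z i).Nonempty := by
  obtain ⟨i, hi⟩ := Finite.exists_max z
  exact ⟨i, by simpa using hi⟩

/-- The index of a largest coordinate (the smallest such index if there are several). -/
noncomputable def argmax {p d : ℕ} [NeZero d] (z : Fin d → FixedPoint p) : Fin d :=
  (Finset.univ.filter fun i => ∀ j, z j ≤ z i).min' (maximizers_nonempty z)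

/-- Concatenation of the one-hot encodings of the letters of a word. -/
def emb (p : ℕ) {q l : ℕ} (x : Fin l → Fin q) : Fin (l * q) → FixedPoint p :=
  fun j => if x (finProdFinEquiv.symm j).1 = (finProdFinEquiv.symm j).2 then 1 else 0

end FixedPoint

open FixedPoint

/-! ## Computation graphs -/

/-- A computation graph over the alphabet `Fin q` with `n` input nodes and `m` output nodes.
Every node is labelled either by an input position or by a local function, and the
in-neighbours of a function node are listed, without repetition, in the order in which its local
function reads them. -/
structure CompGraph (q n m : ℕ) where
  /-- nodes -/
  V : Type
  fintypeV : Fintype V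
  /-- (indices of) the local functions -/
  F : Type
  finiteF : Finite F
  /-- arity of a local function -/
  arity : F → ℕ
  /-- the local functions -/
  fn : (f : F) → (Fin (arity f) → Fin q) → Fin q
  label : V → Fin n ⊕ F
  /-- there is exactly one input node for each input position -/
  existsUnique_input : ∀ i : Fin n, ∃! v, label v = Sum.inl i
  /-- the in-neighbours: none for an input node, `arity f` many for a node labelled `f` -/
  pred : (v : V) → Fin (Sum.elim (fun _ => 0) arity (label v)) → V
  pred_injective : ∀ v, Function.Injective (pred v)
  acyclic : ∀ v, ¬ Relation.TransGen (fun u w => ∃ i, pred w i = u) v v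
  /-- the output nodes, in order -/
  out : Fin m → V
  out_injective : Function.Injective out
  /-- output nodes have out-degree zero -/
  out_not_pred : ∀ (j : Fin m) (w : V) (i), pred w i ≠ out j

namespace CompGraph

variable {q n m : ℕ} (G : CompGraph q n m)

instance : Fintype G.V := G.fintypeV

/-- The edge relation `u → v`. -/
def Edge (u v : G.V) : Prop := ∃ i, G.pred v i = u

/-- The number of nodes. -/
def size : ℕ := Fintype.card G.V

/-- The in-degree of a node. -/
noncomputable def inDegree (v : G.V) : ℕ := {u | G.Edge u v}.ncard

theorem edge_wellFounded : WellFounded G.Edge := by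
  have : Std.Irrefl (Relation.TransGen G.Edge) := ⟨G.acyclic⟩
  exact Subrelation.wf (fun h => Relation.TransGen.single h)
    (Finite.wellFounded_of_trans_of_irrefl (Relation.TransGen G.Edge))

/-- The function computed by a node with a given label from the values of its in-neighbours. -/
def nodeFn (x : Fin n → Fin q) :
    (l : Fin n ⊕ G.F) → (Fin (Sum.elim (fun _ => 0) G.arity l) → Fin q) → Fin q
  | Sum.inl i => fun _ => x i
  | Sum.inr f => G.fn f

/-- The value of a node on input `x`, by recursion along the edges. -/
noncomputable def value (x : Fin n → Fin q) : G.V → Fin q :=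
  G.edge_wellFounded.fix fun v rec =>
    G.nodeFn x (G.label v) fun i => rec (G.pred v i) ⟨i, rfl⟩

theorem value_eq (x : Fin n → Fin q) (v : G.V) :
    G.value x v = G.nodeFn x (G.label v) fun i => G.value x (G.pred v i) :=
  G.edge_wellFounded.fix_eq _ v

/-- The function computed by the graph. -/
noncomputable def eval (x : Fin n → Fin q) : Fin m → Fin q := fun j => G.value x (G.out j)

/-- `ord` enumerates all nodes in a topological order that ends with the output nodes. -/
def IsTopologicalOrder (ord : Fin G.size ≃ G.V) : Prop :=
  (∀ u v, G.Edge u v → ord.symm u < ord.symm v) ∧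
    ∀ j : Fin m, (ord.symm (G.out j) : ℕ) + m = G.size + j

end CompGraph

/-- `f` is approximated by a two-layer `ReLU` network of hidden width `w` with `p`-digit
fixed-point weights and arithmetic: on every input the coordinate of the correct letter exceeds a
threshold `1 - δ`, and all other coordinates stay below it. -/
def ApproximatedBy {q l : ℕ} (f : (Fin l → Fin q) → Fin q) (p w : ℕ) : Prop :=
  ∃ (W₁ : Matrix (Fin w) (Fin (l * q)) (FixedPoint p))
    (W₂ : Matrix (Fin q) (Fin w) (FixedPoint p)),
    ∀ x : Fin l → Fin q, ∃ δ : ℝ, 0 < δ ∧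
      1 - δ < (twoLayer W₁ W₂ (emb p x) (f x)).toRat ∧
      ∀ i, i ≠ f x → ((twoLayer W₁ W₂ (emb p x) i).toRat : ℝ) < 1 - δ

/-- All local functions of the graphs are approximated by two-layer networks of polynomial width
and logarithmic precision. -/
def PolyEfficientlyApproximated {q : ℕ} {m : ℕ → ℕ} (G : ∀ n, CompGraph q n (m n)) : Prop :=
  ∃ p w : ℕ → ℕ, IsLogBounded p ∧ IsPolyBounded w ∧
    ∀ n, 1 ≤ n → ∀ f : (G n).F, ∃ w' ≤ w n, ApproximatedBy ((G n).fn f) (p n) w'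

/-- The in-degrees of all nodes of all graphs are bounded by one constant. -/
def BoundedFanIn {q : ℕ} {m : ℕ → ℕ} (G : ∀ n, CompGraph q n (m n)) : Prop :=
  ∃ k : ℕ, ∀ n, 1 ≤ n → ∀ v : (G n).V, (G n).inDegree v ≤ k

/-! ## Decoder-only transformers with fixed-point arithmetic -/

/-- Parameters of a multi-head attention layer on `d`-dimensional embeddings. -/
structure AttentionLayer (p d : ℕ) where
  /-- number of heads -/
  heads : ℕ
  /-- head size -/
  headSize : ℕ
  queryMat : Fin heads → Matrix (Fin headSize) (Fin d) (FixedPoint p)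
  keyMat : Fin heads → Matrix (Fin headSize) (Fin d) (FixedPoint p)
  valueMat : Fin heads → Matrix (Fin headSize) (Fin d) (FixedPoint p)
  /-- projection of the concatenated heads -/
  outMat : Matrix (Fin d) (Fin (heads * headSize)) (FixedPoint p)

namespace AttentionLayer

variable {p d N : ℕ} (S : AttentionLayer p d)

/-- Attention score of position `j` for position `i`. -/
def score (z : Fin N → Fin d → FixedPoint p) (h : Fin S.heads) (i j : Fin N) : FixedPoint p :=
  dot (matVec (S.queryMat h) (z i)) (matVec (S.keyMat h) (z j))

/-- The positions `j ≤ i` of maximal score (causal masking). -/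
noncomputable def attended (z : Fin N → Fin d → FixedPoint p) (h : Fin S.heads) (i : Fin N) :
    Finset (Fin N) :=
  {j | j ≤ i ∧ ∀ j' ≤ i, S.score z h i j' ≤ S.score z h i j}

/-- Saturated attention: uniform weight on the positions of maximal score, zero elsewhere. -/
noncomputable def weight (z : Fin N → Fin d → FixedPoint p) (h : Fin S.heads) (i j : Fin N) :
    FixedPoint p :=
  if j ∈ S.attended z h i then trunc p (1 / (S.attended z h i).card) else 0

/-- Output of one head at position `i`. -/
noncomputable def headOut (z : Fin N → Fin d → FixedPoint p) (i : Fin N) (h : Fin S.heads) :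
    Fin S.headSize → FixedPoint p :=
  fun a => FixedPoint.sum fun j => S.weight z h i j * matVec (S.valueMat h) (z j) a

/-- The causal self-attention map. -/
noncomputable def apply (z : Fin N → Fin d → FixedPoint p) : Fin N → Fin d → FixedPoint p :=
  fun i => matVec S.outMat fun a =>
    S.headOut z i (finProdFinEquiv.symm a).1 (finProdFinEquiv.symm a).2

/-- Number of scalar parameters. -/
def numParams : ℕ := S.heads * (3 * (S.headSize * d)) + d * (S.heads * S.headSize)

end AttentionLayer

/-- Parameters of a feedforward layer: a standard two-layer network, or a mixture of experts. -/
inductive FeedForward (p d : ℕ) where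
  | standard (w : ℕ) (W₁ : Matrix (Fin w) (Fin d) (FixedPoint p))
      (W₂ : Matrix (Fin d) (Fin w) (FixedPoint p))
  | moe (numExperts w : ℕ) (pos : NeZero numExperts)
      (W₁ : Fin numExperts → Matrix (Fin w) (Fin d) (FixedPoint p))
      (W₂ : Fin numExperts → Matrix (Fin d) (Fin w) (FixedPoint p))
      (gate : Matrix (Fin numExperts) (Fin d) (FixedPoint p))

namespace FeedForward

variable {p d : ℕ}

/-- The map computed by the layer; in a mixture of experts the expert of largest gating score is
applied. -/
noncomputable def apply : FeedForward p d → (Fin d → FixedPoint p) → Fin d → FixedPoint p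
  | standard _ W₁ W₂, z => twoLayer W₁ W₂ z
  | moe _ _ _ W₁ W₂ gate, z => twoLayer (W₁ (argmax (matVec gate z))) (W₂ (argmax (matVec gate z))) z

/-- Number of scalar parameters. -/
def numParams : FeedForward p d → ℕ
  | standard w _ _ => w * d + d * w
  | moe e w _ _ _ _ => e * (w * d + d * w) + e * d

end FeedForward

/-- A decoder-only transformer with vocabulary `Fin q` and `p`-digit fixed-point arithmetic. -/
structure Transformer (q p : ℕ) where
  /-- embedding dimension -/
  d : ℕ
  wordEmb : Fin q → Fin d → FixedPoint p
  posEmb : ℕ → Fin d → FixedPoint p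
  layers : List (AttentionLayer p d × FeedForward p d)
  /-- output matrix -/
  outMat : Matrix (Fin q) (Fin d) (FixedPoint p)

namespace Transformer

variable {q p : ℕ} (M : Transformer q p)

/-- One transformer block: `(id + FF) ∘ (id + SA)`. -/
noncomputable def block {d N : ℕ} (B : AttentionLayer p d × FeedForward p d)
    (z : Fin N → Fin d → FixedPoint p) : Fin N → Fin d → FixedPoint p :=
  let z' : Fin N → Fin d → FixedPoint p := fun i a => z i a + B.1.apply z i a
  fun i a => z' i a + B.2.apply (z' i) a

/-- Sum of word and positional embeddings. -/
def embed (w : List (Fin q)) : Fin w.length → Fin M.d → FixedPoint p :=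
  fun i a => M.wordEmb (w.get i) a + M.posEmb i a

/-- The hidden states after all layers. -/
noncomputable def hidden (w : List (Fin q)) : Fin w.length → Fin M.d → FixedPoint p :=
  M.layers.foldl (fun z B => block B z) (M.embed w)

/-- The logits at a position. -/
noncomputable def logits (w : List (Fin q)) (i : Fin w.length) : Fin q → FixedPoint p :=
  matVec M.outMat (M.hidden w i)

/-- The next token: deterministic decoding at the last position. (The value for the empty sequence
is irrelevant.) -/
noncomputable def next [NeZero q] (w : List (Fin q)) : Fin q :=
  if h : 0 < w.length then argmax (M.logits w ⟨w.length - 1, Nat.sub_one_lt_of_lt h⟩) else 0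

/-- Chain of thought: the token sequence after a given number of decoding steps. -/
noncomputable def cot [NeZero q] (w : List (Fin q)) : ℕ → List (Fin q)
  | 0 => w
  | k + 1 => cot w k ++ [M.next (cot w k)]

/-- Number of scalar parameters when the model runs on sequences of length at most `N`, the
positional embeddings of these positions included. -/
def numParams (N : ℕ) : ℕ :=
  q * M.d + N * M.d + (M.layers.map fun B => B.1.numParams + B.2.numParams).sum + q * M.d

end Transformer

/-! Over a fixed alphabet of `q` letters and with fan-in at most `k`, a local function is a table
with at most `q ^ k` rows. One transformer layer can therefore evaluate a node exactly. The position
embedding is one-hot, so the last position identifies the node that comes next. With `K = k + 1`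
heads, head `h` reads the token at a prescribed earlier position, where the `h`-th in-neighbour was
written (or, for an input node, the input letter). The feedforward layer has a hidden unit for every
pair of a position and a `K`-tuple of tokens. Exactly one of them fires, and it writes the table
entry.

All numbers involved are integers, and every sum is bounded in terms of `K` alone. At a constant
precision nothing is rounded or saturated, and truncated arithmetic agrees with integer arithmetic.
The width is `N * q ^ K` for `N = n + |V|` positions, hence polynomial in `n`.

The argument rests on `dot_intVec` (exact inner products), `headOut_lookupAttention` (a head copies
one position), `apply_lookupFeedForward` (table lookup), `exists_isTopologicalOrder` and
`exists_lookup` (which positions and which table), and `cot_eq_trace` (induction on decoding steps).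
-/

/-! ## Exact integer arithmetic -/

namespace FixedPoint

/-- The fixed-point number representing an integer (exactly, if its absolute value is less than
`2 ^ p`). -/
def ofInt (p : ℕ) (c : ℤ) : FixedPoint p := trunc p c

theorem toRat_ofInt {p : ℕ} {c : ℤ} (hc : |c| ≤ 2 ^ p - 1) : (ofInt p c).toRat = c := by
  have h2 : (1 : ℤ) ≤ 2 ^ p := one_le_pow₀ (by norm_num)
  have hsq : (2 : ℤ) ^ (2 * p) = 2 ^ p * 2 ^ p := by rw [two_mul, pow_add]
  obtain ⟨h₁, h₂⟩ := abs_le.1 hc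
  have hclamp : clampNum p (c * 2 ^ p) = c * 2 ^ p := by
    unfold clampNum
    rw [hsq, min_eq_right (by nlinarith), max_eq_right (by nlinarith)]
  have hfloor : ⌊(c : ℚ) * 2 ^ p⌋ = c * 2 ^ p := by
    rw [show (c : ℚ) * 2 ^ p = ((c * 2 ^ p : ℤ) : ℚ) by push_cast; rfl, Int.floor_intCast]
  have hceil : ⌈(c : ℚ) * 2 ^ p⌉ = c * 2 ^ p := by
    rw [show (c : ℚ) * 2 ^ p = ((c * 2 ^ p : ℤ) : ℚ) by push_cast; rfl, Int.ceil_intCast]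
  simp only [ofInt, toRat, trunc, hfloor, hceil, ite_self, hclamp]
  push_cast
  field_simp

theorem ofInt_zero (p : ℕ) : ofInt p 0 = 0 := by
  change trunc p ((0 : ℤ) : ℚ) = trunc p 0
  rw [Int.cast_zero]

/-- Only the summands need to be representable: both sides truncate the same rational number, so a
saturated sum does no harm here. The same holds for products. -/
theorem ofInt_add {p : ℕ} {a b : ℤ} (ha : |a| ≤ 2 ^ p - 1) (hb : |b| ≤ 2 ^ p - 1) :
    ofInt p a + ofInt p b = ofInt p (a + b) := by
  change trunc p ((ofInt p a).toRat + (ofInt p b).toRat) = trunc p _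
  rw [toRat_ofInt ha, toRat_ofInt hb, Int.cast_add]

theorem ofInt_mul {p : ℕ} {a b : ℤ} (ha : |a| ≤ 2 ^ p - 1) (hb : |b| ≤ 2 ^ p - 1) :
    ofInt p a * ofInt p b = ofInt p (a * b) := by
  change trunc p ((ofInt p a).toRat * (ofInt p b).toRat) = trunc p _
  rw [toRat_ofInt ha, toRat_ofInt hb, Int.cast_mul]

theorem ofInt_le_ofInt {p : ℕ} {a b : ℤ} (ha : |a| ≤ 2 ^ p - 1) (hb : |b| ≤ 2 ^ p - 1) :
    ofInt p a ≤ ofInt p b ↔ a ≤ b := by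
  change (ofInt p a).toRat ≤ (ofInt p b).toRat ↔ _
  rw [toRat_ofInt ha, toRat_ofInt hb, Int.cast_le]

theorem max_ofInt_zero {p : ℕ} {a : ℤ} (ha : |a| ≤ 2 ^ p - 1) :
    max (ofInt p a) 0 = ofInt p (max a 0) := by
  have h0 : |(0 : ℤ)| ≤ 2 ^ p - 1 := by
    rw [abs_zero]; exact (abs_nonneg a).trans ha
  rw [← ofInt_zero]
  rcases le_total a 0 with h | h
  · rw [max_eq_right h, max_eq_right ((ofInt_le_ofInt ha h0).2 h)]
  · rw [max_eq_left h, max_eq_left ((ofInt_le_ofInt h0 ha).2 h)]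

/-- The sum of the absolute values dominates every partial sum, so the left-to-right evaluation
never saturates. -/
theorem foldl_add_map_ofInt {p : ℕ} (l : List ℤ) (a : ℤ)
    (h : |a| + (l.map fun c => |c|).sum ≤ 2 ^ p - 1) :
    (l.map (ofInt p)).foldl (fun a b => a + b) (ofInt p a) = ofInt p (a + l.sum) := by
  induction l generalizing a with
  | nil => simp
  | cons c l ih =>
    have hl : 0 ≤ (l.map fun c => |c|).sum := List.sum_nonneg (by simp)
    simp only [List.map_cons, List.sum_cons, List.foldl_cons] at h ⊢
    rw [ofInt_add (by linarith [abs_nonneg c]) (by linarith [abs_nonneg a]), ih, add_assoc]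
    linarith [abs_add_le a c]

theorem sum_ofInt {p d : ℕ} (c : Fin d → ℤ) (h : ∑ i, |c i| ≤ 2 ^ p - 1) :
    sum (fun i => ofInt p (c i)) = ofInt p (∑ i, c i) := by
  have := foldl_add_map_ofInt (p := p) (List.ofFn c) 0 (by
    rw [List.map_ofFn, List.sum_ofFn]; simpa using h)
  rw [List.map_ofFn, ofInt_zero, List.sum_ofFn, zero_add] at this
  exact this

/-! ### Vectors and matrices with small integer entries. -/

variable {p r d : ℕ} {ι κ : Type*}

/-- The fixed-point vector with given integer coordinates. -/
def intVec (p : ℕ) (e : Fin d ≃ ι) (v : ι → ℤ) : Fin d → FixedPoint p :=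
  fun i => ofInt p (v (e i))

/-- The fixed-point matrix with given integer entries. -/
def intMat (p : ℕ) (e₁ : Fin r ≃ κ) (e₂ : Fin d ≃ ι) (A : κ → ι → ℤ) :
    Matrix (Fin r) (Fin d) (FixedPoint p) :=
  fun i => intVec p e₂ (A (e₁ i))

/-- Since the entries of `u` are at most 1 in absolute value, the ℓ¹ norm of `v` bounds all partial
sums. Later exactness checks thus reduce to ℓ¹ norms of sums of one-hot vectors. -/
theorem dot_intVec [Fintype ι] (hp : 1 ≤ p) (e : Fin d ≃ ι) {u v : ι → ℤ}
    (hu : ∀ i, |u i| ≤ 1) (hv : ∑ i, |v i| ≤ 2 ^ p - 1) :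
    dot (intVec p e u) (intVec p e v) = ofInt p (∑ i, u i * v i) := by
  have hv' : ∀ i, |v i| ≤ 2 ^ p - 1 := fun i =>
    (Finset.single_le_sum (fun j _ => abs_nonneg (v j)) (Finset.mem_univ i)).trans hv
  have h2 : (2 : ℤ) ≤ 2 ^ p := by simpa using pow_le_pow_right₀ (by norm_num : (1 : ℤ) ≤ 2) hp
  have hu' : ∀ i, |u i| ≤ 2 ^ p - 1 := fun i => (hu i).trans (by omega)
  have : (fun j => intVec p e u j * intVec p e v j) = fun j => ofInt p (u (e j) * v (e j)) :=
    funext fun j => ofInt_mul (hu' _) (hv' _)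
  rw [dot, this, sum_ofInt, e.sum_comp fun i => u i * v i]
  rw [e.sum_comp fun i => |u i * v i|]
  refine (Finset.sum_le_sum fun i _ => ?_).trans hv
  rw [abs_mul]
  exact mul_le_of_le_one_left (abs_nonneg _) (hu i)

theorem matVec_intVec [Fintype ι] (hp : 1 ≤ p) (e₁ : Fin r ≃ κ) (e₂ : Fin d ≃ ι) {A : κ → ι → ℤ} {v : ι → ℤ}
    (hA : ∀ k i, |A k i| ≤ 1) (hv : ∑ i, |v i| ≤ 2 ^ p - 1) :
    matVec (intMat p e₁ e₂ A) (intVec p e₂ v) = intVec p e₁ fun k => ∑ i, A k i * v i :=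
  funext fun _ => dot_intVec hp e₂ (hA _) hv

theorem relu_intVec (e : Fin d ≃ ι) {v : ι → ℤ} (hv : ∀ i, |v i| ≤ 2 ^ p - 1) :
    relu (intVec p e v) = intVec p e fun i => max (v i) 0 :=
  funext fun _ => max_ofInt_zero (hv _)

theorem intVec_add (e : Fin d ≃ ι) {u v : ι → ℤ} (hu : ∀ i, |u i| ≤ 2 ^ p - 1)
    (hv : ∀ i, |v i| ≤ 2 ^ p - 1) :
    (fun i => intVec p e u i + intVec p e v i) = intVec p e fun i => u i + v i :=
  funext fun _ => ofInt_add (hu _) (hv _)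

/-- The maximizer is unique, so the tie-breaking rule plays no role. -/
theorem argmax_indicator [NeZero d] (hp : 1 ≤ p) (c : Fin d) :
    argmax (fun a => ofInt p (if a = c then 1 else 0)) = c := by
  have h2 : (2 : ℤ) ≤ 2 ^ p := by simpa using pow_le_pow_right₀ (by norm_num : (1 : ℤ) ≤ 2) hp
  have hs : (Finset.univ.filter fun i : Fin d => ∀ j,
      ofInt p (if j = c then 1 else 0) ≤ ofInt p (if i = c then 1 else 0)) = {c} := by
    have hle : ∀ i j : Fin d, ofInt p (if j = c then 1 else 0) ≤ ofInt p (if i = c then 1 else 0) ↔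
        ((if j = c then 1 else 0 : ℤ) ≤ if i = c then 1 else 0) := fun i j =>
      ofInt_le_ofInt (by split_ifs <;> simp <;> omega) (by split_ifs <;> simp <;> omega)
    ext i
    simp only [hle, Finset.mem_filter, Finset.mem_univ, true_and, Finset.mem_singleton]
    constructor
    · intro h
      by_contra hi
      simpa [hi] using h c
    · rintro rfl j
      by_cases h : j = i <;> simp [h]
  unfold argmax
  simp only [hs, Finset.min'_singleton]

end FixedPoint

/-! ## A one-layer transformer that looks up earlier tokens -/

section Lookup

/-- Coordinates of the embedding: the position, the token, the tokens retrieved by the heads, and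
the next token (all one-hot). -/
abbrev LookupIndex (N q K : ℕ) : Type := Fin N ⊕ Fin q ⊕ (Fin K × Fin q) ⊕ Fin q

variable {N q K p d r : ℕ}

/-- Indicator of a proposition. -/
def ind (P : Prop) [Decidable P] : ℤ := if P then 1 else 0

theorem abs_ind_le (P : Prop) [Decidable P] : |ind P| ≤ 1 := by
  unfold ind; split_ifs <;> simp

/-- The embedding vector whose four parts are given. -/
def lookupVec (a : Fin N → ℤ) (b : Fin q → ℤ) (c : Fin K × Fin q → ℤ) (d : Fin q → ℤ) :
    LookupIndex N q K → ℤ :=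
  Sum.elim a (Sum.elim b (Sum.elim c d))

/-- Query matrix: the one-hot vector of a position is sent to that of the position to look up. -/
def queryEntry (q K : ℕ) (τ : Fin N → Fin N) (s t : LookupIndex N q K) : ℤ :=
  Sum.elim (fun a => lookupVec (fun i => ind (τ i = a)) 0 0 0 t) 0 s

/-- Output matrix of the attention layer: the token read by each head is stored separately. -/
def attnOutEntry (N q K : ℕ) (s : LookupIndex N q K) (t : Fin K × LookupIndex N q K) : ℤ :=
  Sum.elim 0 (Sum.elim 0 (Sum.elim (fun hb => ind (t = (hb.1, Sum.inr (Sum.inl hb.2)))) 0)) s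

/-- First feedforward matrix: the hidden unit `(i, y)` detects position `i` and retrieved tokens
`y`. -/
def detectEntry (v : Fin N × (Fin K → Fin q)) : LookupIndex N q K → ℤ :=
  lookupVec (fun i => ind (v.1 = i)) 0 (fun hb => -ind (v.2 hb.1 ≠ hb.2)) 0

/-- Second feedforward matrix: the hidden unit `(i, y)` writes the token `g i y`. -/
def writeEntry (g : Fin N → (Fin K → Fin q) → Fin q) (s : LookupIndex N q K)
    (u : Fin N × (Fin K → Fin q)) : ℤ :=
  lookupVec 0 0 0 (fun a => ind (a = g u.1 u.2)) s

variable (e : Fin d ≃ LookupIndex N q K) (u : Fin r ≃ Fin N × (Fin K → Fin q))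

/-- Attention layer in which head `h` looks up the position `τ h i` from position `i`. -/
abbrev lookupAttention (p : ℕ) (τ : Fin K → Fin N → Fin N) : AttentionLayer p d where
  heads := K
  headSize := d
  queryMat h := intMat p e e (queryEntry q K (τ h))
  keyMat _ := intMat p e e fun s t => ind (s = t)
  valueMat _ := intMat p e e fun s t => ind (s = t)
  outMat := intMat p e
    (finProdFinEquiv.symm.trans ((Equiv.refl _).prodCongr e))
    (attnOutEntry N q K)

/-- Feedforward layer that applies the function `g i` at position `i`. -/
def lookupFeedForward (p : ℕ) (g : Fin N → (Fin K → Fin q) → Fin q) : FeedForward p d :=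
  .standard r
    (intMat p u e detectEntry)
    (intMat p e u (writeEntry g))

/-- A transformer that produces after position `i` the token `g i y`, where `y h` is the token at
position `τ h i`. -/
def lookupTransformer (p : ℕ) (τ : Fin K → Fin N → Fin N)
    (g : Fin N → (Fin K → Fin q) → Fin q) : Transformer q p where
  d := d
  wordEmb b := intVec p e (lookupVec 0 (fun a => ind (a = b)) 0 0)
  posEmb i := intVec p e (lookupVec (fun a => ind ((a : ℕ) = i)) 0 0 0)
  layers := [(lookupAttention e p τ, lookupFeedForward e u p g)]
  outMat := intMat p (Equiv.refl _) e fun a =>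
    lookupVec 0 0 0 fun b => ind (a = b)

/-! ### Sums over the coordinate blocks and norms of the hidden vectors. -/

theorem sum_lookupIndex (f : LookupIndex N q K → ℤ) :
    ∑ s, f s = ∑ i, f (Sum.inl i) + (∑ b, f (Sum.inr (Sum.inl b)) +
      (∑ h, ∑ b, f (Sum.inr (Sum.inr (Sum.inl (h, b)))) +
        ∑ b, f (Sum.inr (Sum.inr (Sum.inr b))))) := by
  rw [Fintype.sum_sum_type, Fintype.sum_sum_type, Fintype.sum_sum_type, Fintype.sum_prod_type]

theorem sum_ind_mul {α : Type*} [Fintype α] [DecidableEq α] (c : α) (f : α → ℤ) :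
    ∑ a, ind (a = c) * f a = f c := by
  simp [ind]

theorem sum_ind_mul' {α : Type*} [Fintype α] [DecidableEq α] (c : α) (f : α → ℤ) :
    ∑ a, ind (c = a) * f a = f c := by
  simp [ind]

theorem sum_mul_ind {α : Type*} [Fintype α] [DecidableEq α] (c : α) (f : α → ℤ) :
    ∑ a, f a * ind (a = c) = f c := by
  simp [ind]

theorem sum_abs_ind {α : Type*} [Fintype α] [DecidableEq α] (c : α) :
    ∑ a, |ind (a = c)| = 1 := by
  have : ∀ a, |ind (a = c)| = ind (a = c) * 1 := fun a => by
    unfold ind; split_ifs <;> simp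
  simp only [this, sum_ind_mul]

variable (τ : Fin K → Fin N → Fin N) (g : Fin N → (Fin K → Fin q) → Fin q)

/-- The integer vector before the attention layer. -/
def embedVec (K : ℕ) (i : Fin N) (b : Fin q) : LookupIndex N q K → ℤ :=
  lookupVec (fun a => ind (a = i)) (fun a => ind (a = b)) 0 0

/-- The integer vector added by the attention layer. -/
def retrievedVec (N : ℕ) (y : Fin K → Fin q) : LookupIndex N q K → ℤ :=
  lookupVec 0 0 (fun hb => ind (hb.2 = y hb.1)) 0

/-- The integer vector added by the feedforward layer. -/
def nextVec (N K : ℕ) (c : Fin q) : LookupIndex N q K → ℤ :=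
  lookupVec 0 0 0 fun a => ind (a = c)

theorem sum_abs_retrievedVec (y : Fin K → Fin q) : ∑ s, |retrievedVec N y s| = K := by
  simp only [sum_lookupIndex, retrievedVec, lookupVec, Sum.elim_inl, Sum.elim_inr, sum_abs_ind]
  simp

theorem sum_abs_nextVec (c : Fin q) : ∑ s, |nextVec N K c s| = 1 := by
  simp [nextVec, lookupVec, sum_abs_ind]

theorem sum_abs_embedVec (i : Fin N) (b : Fin q) : ∑ s, |embedVec K i b s| = 2 := by
  simp [embedVec, lookupVec, sum_abs_ind]

theorem abs_embedVec_le (i : Fin N) (b : Fin q) (s) : |embedVec K i b s| ≤ 1 := by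
  rcases s with a | a | a | a <;> simp [embedVec, lookupVec, abs_ind_le]

theorem abs_retrievedVec_le (y : Fin K → Fin q) (s) : |retrievedVec N y s| ≤ 1 := by
  rcases s with a | a | a | a <;> simp [retrievedVec, lookupVec, abs_ind_le]

theorem abs_nextVec_le (c : Fin q) (s) : |nextVec N K c s| ≤ 1 := by
  rcases s with a | a | a | a <;> simp [nextVec, lookupVec, abs_ind_le]

theorem embed_lookupTransformer (hp : 1 ≤ p) (w : List (Fin q)) (hw : w.length ≤ N) :
    (lookupTransformer e u p τ g).embed w = fun i =>
      intVec p e (embedVec K (Fin.castLE hw i) (w.get i)) := by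
  have h2 : (2 : ℤ) ≤ 2 ^ p := by simpa using pow_le_pow_right₀ (by norm_num : (1 : ℤ) ≤ 2) hp
  funext i
  refine (intVec_add e (fun s => ?_) fun s => ?_).trans ?_
  · refine le_trans ?_ (show (1 : ℤ) ≤ 2 ^ p - 1 by linarith)
    rcases s with a | a | a | a <;> simp [lookupVec, abs_ind_le]
  · refine le_trans ?_ (show (1 : ℤ) ≤ 2 ^ p - 1 by linarith)
    rcases s with a | a | a | a <;> simp [lookupVec, abs_ind_le]
  · congr 1
    funext s
    rcases s with a | a | a | a <;> simp [lookupVec, embedVec, Fin.ext_iff]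

/-! ### The attention layer: each head copies one position. -/

section Attention

variable {L : ℕ} (hL : L ≤ N) (w : Fin L → Fin q)

/-- The hidden states before the attention layer. -/
def embedState (p : ℕ) (hL : L ≤ N) (w : Fin L → Fin q) : Fin L → Fin d → FixedPoint p :=
  fun i => intVec p e (embedVec K (Fin.castLE hL i) (w i))

/-- Keys and values are the embeddings themselves. Their ℓ¹ norm is 2 (one position, one token),
which is why `p ≥ 2` is required. -/
theorem matVec_identity (hp : 2 ≤ p) (i : Fin L) :
    matVec (intMat p e e fun s t => ind (s = t))
      (embedState e p hL w i) = embedState e p hL w i := by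
  have h4 : (4 : ℤ) ≤ 2 ^ p := by simpa using pow_le_pow_right₀ (by norm_num : (1 : ℤ) ≤ 2) hp
  refine (matVec_intVec (by omega) _ _ (fun _ _ => abs_ind_le _) ?_).trans ?_
  · rw [sum_abs_embedVec]; linarith
  · simp only [sum_ind_mul']; rfl

/-- The query is the one-hot vector of the target position, with zeros in the other blocks. Its
product with a key compares positions and ignores tokens. -/
theorem score_lookupAttention (hp : 2 ≤ p) (h : Fin K) (i j : Fin L) :
    (lookupAttention e p τ).score (embedState e p hL w) h i j =
      ofInt p (ind (τ h (Fin.castLE hL i) = Fin.castLE hL j)) := by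
  have h4 : (4 : ℤ) ≤ 2 ^ p := by simpa using pow_le_pow_right₀ (by norm_num : (1 : ℤ) ≤ 2) hp
  have hQ : ∀ s t, |queryEntry q K (τ h) s t| ≤ 1 := fun s t => by
    rcases s with a | a | a | a <;> rcases t with b | b | b | b <;>
      simp [queryEntry, lookupVec, abs_ind_le]
  have hq : matVec (intMat p e e (queryEntry q K (τ h)))
      (embedState e p hL w i) = intVec p e
        (lookupVec (fun a => ind (τ h (Fin.castLE hL i) = a)) 0 0 0) := by
    refine (matVec_intVec (by omega) _ _ hQ ?_).trans ?_
    · rw [sum_abs_embedVec]; linarith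
    · congr 1
      funext s
      rcases s with a | a | a | a <;>
        simp only [sum_lookupIndex, queryEntry, lookupVec, embedVec, Sum.elim_inl, Sum.elim_inr,
          Pi.zero_apply, zero_mul, mul_zero, Finset.sum_const_zero, add_zero]
      exact sum_mul_ind (Fin.castLE hL i) fun x => ind (τ h x = a)
  rw [AttentionLayer.score, hq, matVec_identity e hL w hp]
  refine (dot_intVec (by omega) _ (fun s => ?_) ?_).trans ?_
  · rcases s with a | a | a | a <;> simp [lookupVec, abs_ind_le]
  · rw [sum_abs_embedVec]; linarith
  · congr 1
    simp [lookupVec, embedVec, sum_ind_mul']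

theorem attended_lookupAttention (hp : 2 ≤ p) (h : Fin K) (i t : Fin L)
    (ht : τ h (Fin.castLE hL i) = Fin.castLE hL t) (hti : t ≤ i) :
    (lookupAttention e p τ).attended (embedState e p hL w) h i = {t} := by
  have h4 : (4 : ℤ) ≤ 2 ^ p := by simpa using pow_le_pow_right₀ (by norm_num : (1 : ℤ) ≤ 2) hp
  have hle : ∀ (P Q : Prop) [Decidable P] [Decidable Q],
      ofInt p (ind P) ≤ ofInt p (ind Q) ↔ ind P ≤ ind Q := fun P Q _ _ =>
    ofInt_le_ofInt ((abs_ind_le _).trans (by linarith)) ((abs_ind_le _).trans (by linarith))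
  have hc : ∀ j, Fin.castLE hL t = Fin.castLE hL j ↔ j = t := fun j => by
    simp [Fin.ext_iff, eq_comm]
  ext j
  simp only [AttentionLayer.attended, Finset.mem_filter, Finset.mem_univ, true_and,
    Finset.mem_singleton, score_lookupAttention e τ hL w hp, ht, hle, hc]
  constructor
  · rintro ⟨-, hj⟩
    by_contra hne
    simpa [ind, hne] using hj t hti
  · rintro rfl
    refine ⟨hti, fun k _ => ?_⟩
    by_cases hk : k = j <;> simp [ind, hk]

/-- A single position is attended, so its weight is the truncation of `1 / 1` and averaging causes
no rounding error. -/
theorem headOut_lookupAttention (hp : 2 ≤ p) (h : Fin K) (i t : Fin L)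
    (ht : τ h (Fin.castLE hL i) = Fin.castLE hL t) (hti : t ≤ i) :
    (lookupAttention e p τ).headOut (embedState e p hL w) i h = embedState e p hL w t := by
  have h4 : (4 : ℤ) ≤ 2 ^ p := by simpa using pow_le_pow_right₀ (by norm_num : (1 : ℤ) ≤ 2) hp
  have hweight : ∀ j, (lookupAttention e p τ).weight (embedState e p hL w) h i j =
      ofInt p (ind (j = t)) := fun j => by
    rw [AttentionLayer.weight, attended_lookupAttention e τ hL w hp h i t ht hti]
    by_cases hj : j = t
    · simp [hj, ind, ofInt]
    · simp [hj, ind, ofInt_zero]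
  funext a
  have hterm : (fun j => (lookupAttention e p τ).weight (embedState e p hL w) h i j *
      matVec ((lookupAttention e p τ).valueMat h) (embedState e p hL w j) a) = fun j =>
      ofInt p (ind (j = t) * embedVec K (Fin.castLE hL j) (w j) (e a)) := by
    funext j
    have := congrFun (matVec_identity e hL w hp j) a
    rw [hweight]
    refine (congrArg _ this).trans (ofInt_mul ((abs_ind_le _).trans (by linarith))
      ((abs_embedVec_le _ _ _).trans (by linarith)))
  rw [AttentionLayer.headOut, hterm, sum_ofInt, sum_ind_mul]
  · rfl
  · refine (Finset.sum_le_sum fun j _ => ?_).trans ((sum_abs_ind t).trans_le (by linarith))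
    rw [abs_mul]
    exact mul_le_of_le_one_right (abs_nonneg _) (abs_embedVec_le _ _ _)

theorem apply_lookupAttention (hp : 2 ≤ p) (hK : 2 * (K : ℤ) ≤ 2 ^ p - 1) (i : Fin L)
    (t : Fin K → Fin L) (ht : ∀ h, τ h (Fin.castLE hL i) = Fin.castLE hL (t h))
    (hti : ∀ h, t h ≤ i) :
    (lookupAttention e p τ).apply (embedState e p hL w) i =
      intVec p e (retrievedVec N fun h => w (t h)) := by
  have hcat : (fun a => (lookupAttention e p τ).headOut (embedState e p hL w) i
      (finProdFinEquiv.symm a).1 (finProdFinEquiv.symm a).2) =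
      intVec p (finProdFinEquiv.symm.trans ((Equiv.refl _).prodCongr e))
        fun hs : Fin K × LookupIndex N q K =>
          embedVec K (Fin.castLE hL (t hs.1)) (w (t hs.1)) hs.2 := by
    funext a
    rw [headOut_lookupAttention e τ hL w hp _ i _ (ht _) (hti _)]
    rfl
  refine (congrArg (matVec (lookupAttention e p τ).outMat) hcat).trans ?_
  refine (matVec_intVec (by omega) _ _ (fun s u => ?_) ?_).trans ?_
  · rcases s with a | a | a | a <;> simp [attnOutEntry, abs_ind_le]
  -- Each head contributes norm 2, since it copies a whole embedding; this is the source of the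
  -- bound `2 * K`. The output matrix then keeps only the token part.
  · rw [Fintype.sum_prod_type]
    simp only [sum_abs_embedVec]
    simpa [mul_comm] using hK
  · congr 1
    funext s
    rcases s with a | a | a | a <;>
      simp [attnOutEntry, retrievedVec, lookupVec, sum_ind_mul, embedVec]

end Attention

/-! ### The feedforward layer as a table, and the next token. -/

theorem apply_lookupFeedForward (hp : 1 ≤ p) (hK : (K : ℤ) + 2 ≤ 2 ^ p - 1) (i : Fin N) (b : Fin q)
    (y : Fin K → Fin q) :
    (lookupFeedForward e u p g).apply (intVec p e
        fun s => embedVec K i b s + retrievedVec N y s) =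
      intVec p e (nextVec N K (g i y)) := by
  have hpre : ∀ v : Fin N × (Fin K → Fin q),
      ∑ s, detectEntry v s * (embedVec K i b s + retrievedVec N y s) =
        ind (v.1 = i) - ∑ h, ind (v.2 h ≠ y h) := fun v => by
    simp only [sum_lookupIndex, detectEntry, embedVec, retrievedVec, lookupVec, Sum.elim_inl,
      Sum.elim_inr, Pi.zero_apply, add_zero, zero_add, mul_zero, zero_mul,
      Finset.sum_const_zero, sum_mul_ind]
    rw [Finset.sum_neg_distrib]
    rfl
  -- Each mismatched token subtracts 1 from a position term that is at most 1, so one mismatch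
  -- already silences the unit. After `ReLU` the hidden layer is one-hot at `(i, y)`.
  have hpos : ∀ v : Fin N × (Fin K → Fin q),
      max (ind (v.1 = i) - ∑ h, ind (v.2 h ≠ y h)) 0 = ind (v = (i, y)) := fun v => by
    obtain ⟨j, z⟩ := v
    by_cases hz : z = y
    · subst hz
      by_cases hj : j = i <;> simp [ind, hj]
    · obtain ⟨h, hh⟩ := Function.ne_iff.1 hz
      have h₁ : 1 ≤ ∑ h, ind (z h ≠ y h) := by
        refine le_trans ?_ (Finset.single_le_sum (f := fun h => ind (z h ≠ y h))
          (fun h _ => ?_) (Finset.mem_univ h))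
        · simp [ind, hh]
        · unfold ind; split_ifs <;> simp
      have h₂ := (abs_le.1 (abs_ind_le (j = i))).2
      rw [max_eq_right (by simp only; linarith)]
      simp [ind, hz]
  have habs : ∀ v : Fin N × (Fin K → Fin q),
      |ind (v.1 = i) - ∑ h, ind (v.2 h ≠ y h)| ≤ 2 ^ p - 1 := fun v => by
    refine (abs_sub _ _).trans ?_
    have h₁ : |∑ h, ind (v.2 h ≠ y h)| ≤ K := by
      refine (Finset.abs_sum_le_sum_abs _ _).trans
        ((Finset.sum_le_sum fun h _ => abs_ind_le _).trans ?_)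
      simp
    linarith [abs_ind_le (v.1 = i)]
  have hpre' : matVec (intMat p u e detectEntry)
      (intVec p e fun s => embedVec K i b s + retrievedVec N y s) =
      intVec p u fun v => ind (v.1 = i) - ∑ h, ind (v.2 h ≠ y h) := by
    refine (matVec_intVec hp _ _ (fun v s => ?_) ?_).trans ?_
    · rcases s with a | a | a | a <;> simp [detectEntry, lookupVec, abs_ind_le]
    · refine (Finset.sum_le_sum fun s _ => abs_add_le _ _).trans ?_
      rw [Finset.sum_add_distrib, sum_abs_embedVec, sum_abs_retrievedVec]
      linarith
    · simp only [hpre]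
  change matVec _ (relu (matVec _ _)) = _
  rw [hpre', relu_intVec _ habs]
  simp only [hpos]
  refine (matVec_intVec hp _ _ (fun s u => ?_) ?_).trans ?_
  · rcases s with a | a | a | a <;> simp [writeEntry, lookupVec, abs_ind_le]
  · rw [sum_abs_ind]; linarith
  · simp only [sum_mul_ind]
    rfl

/-- The bound `2 * K + 3` covers all norms that occur: `2 * K` for the concatenated heads, `K + 2`
before the feedforward layer and `K + 3` for the final state. -/
theorem next_lookupTransformer [NeZero q] (hp : 2 ≤ p) (hK : 2 * (K : ℤ) + 3 ≤ 2 ^ p - 1)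
    (w : List (Fin q)) (hw : w.length ≤ N) (hpos : 0 < w.length)
    (hτ : ∀ h i, τ h i ≤ i) (i : Fin N) (hi : (i : ℕ) + 1 = w.length) :
    (lookupTransformer e u p τ g).next w =
      g i fun h => w[(τ h i : ℕ)]'(by have : (τ h i : ℕ) ≤ i := hτ h i; omega) := by
  have hK0 : (0 : ℤ) ≤ K := Int.natCast_nonneg K
  let l : Fin w.length := ⟨w.length - 1, Nat.sub_one_lt_of_lt hpos⟩
  have hl : Fin.castLE hw l = i := Fin.ext (by simp [l]; omega)
  have hlt : ∀ h, (τ h i : ℕ) < w.length := fun h => by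
    have : (τ h i : ℕ) ≤ i := hτ h i
    omega
  let y : Fin K → Fin q := fun h => w[(τ h i : ℕ)]'(hlt h)
  have hattn := apply_lookupAttention (p := p) e τ hw w.get hp (by linarith) l
    (fun h => ⟨τ h i, hlt h⟩) (fun h => by rw [hl]; rfl) (fun h => by
      have : (τ h i : ℕ) ≤ i := hτ h i
      change (τ h i : ℕ) ≤ w.length - 1
      omega)
  have hmid : (fun a => embedState e p hw w.get l a +
      (lookupAttention e p τ).apply (embedState e p hw w.get) l a) =
      intVec p e fun s => embedVec K i (w.get l) s + retrievedVec N y s := by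
    rw [hattn, embedState, hl]
    exact intVec_add _ (fun s => (abs_embedVec_le _ _ _).trans (by linarith))
      fun s => (abs_retrievedVec_le _ _).trans (by linarith)
  have hhid : (lookupTransformer e u p τ g).hidden w l = intVec p e fun s =>
      embedVec K i (w.get l) s + retrievedVec N y s +
        nextVec N K (g i y) s := by
    have hemb : (lookupTransformer e u p τ g).embed w = embedState e p hw w.get :=
      embed_lookupTransformer e u τ g (by omega) w hw
    have : (lookupTransformer e u p τ g).hidden w l = fun a =>
        (fun a => embedState e p hw w.get l a +
          (lookupAttention e p τ).apply (embedState e p hw w.get) l a) a +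
        (lookupFeedForward e u p g).apply (fun a => embedState e p hw w.get l a +
          (lookupAttention e p τ).apply (embedState e p hw w.get) l a) a := by
      rw [← hemb]; rfl
    rw [this, hmid, apply_lookupFeedForward e u g (by omega) (by linarith)]
    refine intVec_add _ (fun s => ?_) fun s => ?_
    · have h₁ := abs_embedVec_le (K := K) i (w.get l) s
      have h₂ := abs_retrievedVec_le (N := N) y s
      exact (abs_add_le _ _).trans (by linarith)
    · exact (abs_nextVec_le _ _).trans (by linarith)
  have hlogits : (lookupTransformer e u p τ g).logits w l =
      fun a => ofInt p (if a = g i y then 1 else 0) := by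
    rw [Transformer.logits, hhid]
    change matVec (intMat p (Equiv.refl _) e fun a => lookupVec 0 0 0 fun b => ind (a = b)) _ = _
    refine (matVec_intVec (by omega) _ _ (fun a s => ?_) ?_).trans ?_
    · rcases s with b | b | b | b <;> simp [lookupVec, abs_ind_le]
    · refine (Finset.sum_le_sum fun s _ => abs_add_three _ _ _).trans ?_
      rw [Finset.sum_add_distrib, Finset.sum_add_distrib, sum_abs_embedVec, sum_abs_retrievedVec,
        sum_abs_nextVec]
      linarith
    · funext a
      simp only [intVec, sum_lookupIndex, embedVec, retrievedVec, nextVec, lookupVec, Sum.elim_inl,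
        Sum.elim_inr, Pi.zero_apply, add_zero, zero_add, zero_mul, Finset.sum_const_zero,
        sum_ind_mul']
      rfl
  rw [Transformer.next, dif_pos hpos]
  change argmax ((lookupTransformer e u p τ g).logits w l) = _
  rw [hlogits]
  exact argmax_indicator (by omega) _

end Lookup

/-! ## Topological orders -/

namespace CompGraph

variable {q n m : ℕ} (G : CompGraph q n m)

/-- A numbering of the nodes that increases along edges and puts the output nodes last. -/
theorem exists_topological_key : ∃ key : G.V → ℕ, Function.Injective key ∧
    (∀ u v, G.Edge u v → key u < key v) ∧
    (∀ i j, i < j → key (G.out i) < key (G.out j)) ∧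
    ∀ v, (∀ j, v ≠ G.out j) → ∀ j, key v < key (G.out j) := by
  classical
  -- The number of ancestors grows strictly along an edge `u → v`: by acyclicity `u` is an ancestor
  -- of `v` but not of itself.
  let depth : G.V → ℕ := fun v => (Finset.univ.filter fun u => Relation.TransGen G.Edge u v).card
  have hdepth : ∀ u v, G.Edge u v → depth u < depth v := fun u v h => by
    refine Finset.card_lt_card ⟨fun w hw => ?_, fun hs => ?_⟩
    · simp only [Finset.mem_filter, Finset.mem_univ, true_and] at hw ⊢
      exact hw.tail h
    · have := hs (x := u) (by simpa using Relation.TransGen.single h)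
      exact G.acyclic u (Finset.mem_filter.1 this).2
  have hdepth_le : ∀ v, depth v ≤ G.size := fun v => Finset.card_le_univ _
  -- Output nodes are lifted above every possible depth. Edges still increase the level because no
  -- edge leaves an output node.
  let level : G.V → ℕ := fun v => if h : ∃ j, v = G.out j then G.size + 1 + h.choose else depth v
  have hout : ∀ j, level (G.out j) = G.size + 1 + j := fun j => by
    have h : ∃ i, G.out j = G.out i := ⟨j, rfl⟩
    simp only [level, dif_pos h]
    rw [← G.out_injective h.choose_spec]
  have hnot : ∀ v, (∀ j, v ≠ G.out j) → level v = depth v := fun v hv => by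
    simp only [level]
    rw [dif_neg]
    rintro ⟨j, hj⟩
    exact hv j hj
  let idx : G.V ≃ Fin G.size := Fintype.equivFin G.V
  -- Lexicographic order: as `idx v < G.size`, the index only breaks ties between equal levels.
  let key : G.V → ℕ := fun v => level v * G.size + idx v
  have hkey : ∀ u v, level u < level v → key u < key v := fun u v h => by
    have h₁ : (level u + 1) * G.size ≤ level v * G.size := Nat.mul_le_mul_right _ h
    have h₂ := (idx u).isLt
    simp only [key]
    linarith
  refine ⟨key, fun u v h => ?_, fun u v h => hkey u v ?_, fun i j h => hkey _ _ ?_,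
    fun v hv j => hkey _ _ ?_⟩
  · have h₁ : level u = level v := by
      by_contra hne
      rcases lt_or_gt_of_ne hne with hlt | hlt
      · exact (hkey _ _ hlt).ne h
      · exact (hkey _ _ hlt).ne' h
    apply idx.injective
    simp only [key, h₁] at h
    omega
  · rw [hnot u]
    · by_cases hv : ∃ j, v = G.out j
      · obtain ⟨j, rfl⟩ := hv
        rw [hout]
        have := hdepth_le u
        omega
      · rw [hnot v (by simpa using hv)]
        exact hdepth u v h
    · rintro j rfl
      obtain ⟨i, hi⟩ := h
      exact G.out_not_pred j v i hi
  · rw [hout, hout]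
    have : (i : ℕ) < j := h
    omega
  · rw [hnot v hv, hout]
    have := hdepth_le v
    omega

theorem exists_isTopologicalOrder : ∃ ord : Fin G.size ≃ G.V, G.IsTopologicalOrder ord := by
  classical
  obtain ⟨key, hinj, hedge, hout, hlast⟩ := G.exists_topological_key
  let _ : LinearOrder G.V := LinearOrder.lift' key hinj
  have hlt : ∀ u v : G.V, u < v ↔ key u < key v := fun _ _ => Iff.rfl
  have hmono : StrictMono G.out := fun i j h => hout i j h
  let o : Fin G.size ≃o G.V := Fintype.orderIsoFinOfCardEq G.V rfl
  refine ⟨o.toEquiv, fun u v h => o.symm.lt_iff_lt.2 (hedge u v h), fun j => ?_⟩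
  -- From `G.out j` onwards the order contains exactly the outputs with index at least `j`. Counting
  -- this tail determines the position.
  have h₁ : (Finset.Ici (o.symm (G.out j))).card = (Finset.Ici j).card := by
    refine (Finset.card_bij (fun i _ => o.symm (G.out i)) ?_ ?_ ?_).symm
    · intro i hi
      simpa [hmono.le_iff_le] using hi
    · intro a _ b _ h
      exact G.out_injective (o.symm.injective h)
    · intro k hk
      rw [Finset.mem_Ici, ← o.le_iff_le, o.apply_symm_apply] at hk
      have : ∃ i, o k = G.out i := by
        by_contra hne
        exact absurd (hlast (o k) (by simpa using hne) j) (not_lt.2 hk)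
      obtain ⟨i, hi⟩ := this
      rw [hi, hmono.le_iff_le] at hk
      exact ⟨i, by simpa using hk, by rw [← hi, o.symm_apply_apply]⟩
  rw [Fin.card_Ici, Fin.card_Ici] at h₁
  have h₂ := (o.symm (G.out j)).isLt
  have h₃ := j.isLt
  change ((o.symm (G.out j) : Fin G.size) : ℕ) + m = G.size + j
  omega

end CompGraph

/-! ## Polynomial bounds -/

theorem IsPolyBounded.const (a : ℕ) : IsPolyBounded fun _ => a :=
  ⟨0, a, fun n _ => by simp⟩

theorem IsPolyBounded.id : IsPolyBounded fun n => n :=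
  ⟨1, 1, fun n _ => by simp⟩

theorem IsPolyBounded.add {f g : ℕ → ℕ} (hf : IsPolyBounded f) (hg : IsPolyBounded g) :
    IsPolyBounded fun n => f n + g n := by
  obtain ⟨k, a, hf⟩ := hf
  obtain ⟨l, b, hg⟩ := hg
  refine ⟨k + l, a + b, fun n hn => ?_⟩
  have h₁ : n ^ k ≤ n ^ (k + l) := Nat.pow_le_pow_right hn (by omega)
  have h₂ : n ^ l ≤ n ^ (k + l) := Nat.pow_le_pow_right hn (by omega)
  rw [add_mul]
  exact add_le_add ((hf n hn).trans (Nat.mul_le_mul_left _ h₁))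
    ((hg n hn).trans (Nat.mul_le_mul_left _ h₂))

theorem IsPolyBounded.mul {f g : ℕ → ℕ} (hf : IsPolyBounded f) (hg : IsPolyBounded g) :
    IsPolyBounded fun n => f n * g n := by
  obtain ⟨k, a, hf⟩ := hf
  obtain ⟨l, b, hg⟩ := hg
  refine ⟨k + l, a * b, fun n hn => ?_⟩
  rw [pow_add, mul_mul_mul_comm]
  exact Nat.mul_le_mul (hf n hn) (hg n hn)

/-! ## Parameter size of the lookup transformer -/

/-- Embedding dimension of the lookup transformer. -/
def lookupDim (N q K : ℕ) : ℕ := N + (q + (K * q + q))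

/-- Parameter size of the lookup transformer. -/
def lookupSize (N q K : ℕ) : ℕ :=
  q * lookupDim N q K + N * lookupDim N q K +
    (K * (3 * (lookupDim N q K * lookupDim N q K)) + lookupDim N q K * (K * lookupDim N q K) +
      (N * q ^ K * lookupDim N q K + lookupDim N q K * (N * q ^ K))) + q * lookupDim N q K

/-- The exponential factor `q ^ K` is a constant, because neither `q` nor `K` varies with `n`. -/
theorem IsPolyBounded.lookupSize {N : ℕ → ℕ} (hN : IsPolyBounded N) (q K : ℕ) :
    IsPolyBounded fun n => lookupSize (N n) q K := by
  have hd : IsPolyBounded fun n => lookupDim (N n) q K := hN.add (const _)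
  have hr : IsPolyBounded fun n => N n * q ^ K := hN.mul (const _)
  exact ((((const q).mul hd).add (hN.mul hd)).add
    ((((const K).mul ((const 3).mul (hd.mul hd))).add (hd.mul ((const K).mul hd))).add
      ((hr.mul hd).add (hd.mul hr)))).add ((const q).mul hd)

theorem exists_lookupTransformer {N q K p : ℕ} [NeZero q] (hp : 2 ≤ p)
    (hK : 2 * (K : ℤ) + 3 ≤ 2 ^ p - 1) (τ : Fin N → Fin K → Fin N)
    (g : Fin N → (Fin K → Fin q) → Fin q) (hτ : ∀ i h, τ i h ≤ i) :
    ∃ M : Transformer q p, M.numParams N = lookupSize N q K ∧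
      ∀ (w : List (Fin q)) (i : Fin N) (hi : (i : ℕ) + 1 = w.length),
        M.next w = g i fun h => w[(τ i h : ℕ)]'(by have : (τ i h : ℕ) ≤ i := hτ i h; omega) := by
  have hd : Fintype.card (LookupIndex N q K) = lookupDim N q K := by simp [lookupDim]
  have hr : Fintype.card (Fin N × (Fin K → Fin q)) = N * q ^ K := by simp
  refine ⟨lookupTransformer (Fintype.equivFinOfCardEq hd).symm
    (Fintype.equivFinOfCardEq hr).symm p (fun h i => τ i h) g, ?_, fun w i hi => ?_⟩
  · simp [Transformer.numParams, lookupTransformer, AttentionLayer.numParams,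
      FeedForward.numParams, lookupFeedForward, lookupSize]
  · exact next_lookupTransformer _ _ _ g hp hK w (by omega) (by omega) (fun h i => hτ i h) i hi

/-! ## Simulation of computation graphs -/

namespace CompGraph

variable {q n m : ℕ} (G : CompGraph q n m)

/-- In-neighbours are listed without repetition, so the arity equals the in-degree. -/
theorem arity_le_of_inDegree_le {k : ℕ} {v : G.V} {f : G.F} (hf : G.label v = Sum.inr f)
    (hv : G.inDegree v ≤ k) : G.arity f ≤ k := by
  have h : G.inDegree v = Sum.elim (fun _ => 0) G.arity (G.label v) := by
    have : {u | G.Edge u v} = Set.range (G.pred v) := rfl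
    rw [inDegree, this, ← Set.image_univ, Set.ncard_image_of_injective _ (G.pred_injective v),
      Set.ncard_univ, Nat.card_eq_fintype_card, Fintype.card_fin]
  rw [hf] at h
  exact h.symm.le.trans hv

/-- The input followed by the node values in a given order. -/
noncomputable def trace (ord : Fin G.size ≃ G.V) (x : Fin n → Fin q) :
    Fin (n + G.size) → Fin q :=
  Fin.append x fun k => G.value x (ord k)

/-- Every node value is a function of at most `K` earlier entries of the trace. -/
theorem exists_lookup {K : ℕ} (hK : ∀ v, G.inDegree v + 1 ≤ K) {ord : Fin G.size ≃ G.V}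
    (hord : G.IsTopologicalOrder ord) [NeZero q] (i : Fin (n + G.size)) :
    ∃ (τ : Fin K → Fin (n + G.size)) (g : (Fin K → Fin q) → Fin q), (∀ h, τ h ≤ i) ∧
      ∀ (x : Fin n → Fin q) (t : Fin G.size), (i : ℕ) + 1 = n + t →
        g (fun h => G.trace ord x (τ h)) = G.value x (ord t) := by
  -- The token after position `i` is the value of node `t` when `i + 1 = n + t`. For other positions
  -- nothing is asked, and any choice will do.
  by_cases ht : ∃ t : Fin G.size, (i : ℕ) + 1 = n + t
  swap
  · exact ⟨fun _ => i, 0, fun _ => le_rfl, fun x t h => absurd ⟨t, h⟩ ht⟩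
  obtain ⟨t, ht⟩ := ht
  have huniq : ∀ t' : Fin G.size, (i : ℕ) + 1 = n + t' → t' = t := fun t' h =>
    Fin.ext (by omega)
  suffices H : ∃ (τ : Fin K → Fin (n + G.size)) (g : (Fin K → Fin q) → Fin q), (∀ h, τ h ≤ i) ∧
      ∀ x : Fin n → Fin q, g (fun h => G.trace ord x (τ h)) = G.value x (ord t) by
    obtain ⟨τ, g, h₁, h₂⟩ := H
    exact ⟨τ, g, h₁, fun x t' h => by rw [huniq t' h, h₂]⟩
  simp only [G.value_eq _ (ord t)]
  have hedge : ∀ a, G.Edge (G.pred (ord t) a) (ord t) := fun a => ⟨a, rfl⟩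
  -- The `+ 1` in `hK` guarantees a head even at in-degree 0: an input node needs one to copy its
  -- letter.
  have hpos : 0 < K := (Nat.succ_pos _).trans_le (hK (ord t))
  have harity := fun f hf => G.arity_le_of_inDegree_le (f := f) hf
    (show G.inDegree (ord t) ≤ K by have := hK (ord t); omega)
  -- The type of `pred` depends on the label, so both are generalized before the case split.
  generalize G.pred (ord t) = pr at hedge ⊢
  generalize G.label (ord t) = lab at pr hedge harity ⊢
  rcases lab with j | f
  · refine ⟨fun _ => Fin.castAdd _ j, fun y => y ⟨0, hpos⟩, fun _ => ?_, fun x => ?_⟩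
    · change (j : ℕ) ≤ i
      omega
    · simp [trace, nodeFn]
  · have hf : G.arity f ≤ K := harity f rfl
    -- In-neighbours are read where the chain of thought wrote them, after the `n` input tokens;
    -- topological order puts these positions at or before `i`. Superfluous heads read position `i`,
    -- and their result is discarded.
    refine ⟨fun h => if hh : (h : ℕ) < G.arity f then
      Fin.natAdd n (ord.symm (pr ⟨h, hh⟩)) else i, fun y => G.fn f fun a => y (Fin.castLE hf a),
      fun h => ?_, fun x => ?_⟩
    · dsimp only
      split_ifs with hh
      · have h₁ := hord.1 _ _ (hedge ⟨h, hh⟩)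
        rw [Equiv.symm_apply_apply] at h₁
        have h₂ : (ord.symm (pr ⟨h, hh⟩) : ℕ) < t := h₁
        change n + (ord.symm (pr ⟨h, hh⟩) : ℕ) ≤ i
        omega
      · exact le_rfl
    · simp only [nodeFn]
      congr 1
      funext a
      have ha : ((Fin.castLE hf a : Fin K) : ℕ) < G.arity f := a.isLt
      simp [trace, Fin.append_right]

/-- A transformer that continues every prefix of the trace correctly generates the trace. -/
theorem cot_eq_trace [NeZero q] {p : ℕ} (M : Transformer q p) (ord : Fin G.size ≃ G.V)
    (x : Fin n → Fin q) (hM : ∀ t : Fin G.size,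
      M.next ((List.ofFn (G.trace ord x)).take (n + t)) = G.value x (ord t)) :
    M.cot (List.ofFn x) G.size = List.ofFn x ++ List.ofFn fun k => G.value x (ord k) := by
  have happ : List.ofFn (G.trace ord x) =
      List.ofFn x ++ List.ofFn fun k => G.value x (ord k) := List.ofFn_fin_append _ _
  have key : ∀ t ≤ G.size, M.cot (List.ofFn x) t = (List.ofFn (G.trace ord x)).take (n + t) := by
    intro t ht
    induction t with
    | zero => rw [happ, add_zero]; simp [Transformer.cot]
    | succ t ih =>
      have hlt : n + t < (List.ofFn (G.trace ord x)).length := by simp; omega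
      rw [Transformer.cot, ih (by omega), hM ⟨t, ht⟩, ← add_assoc, ← List.take_concat_get' _ _ hlt]
      congr 2
      rw [List.getElem_ofFn]
      exact (Fin.append_right x (fun k => G.value x (ord k)) ⟨t, ht⟩).symm
  rw [key _ le_rfl, ← happ, List.take_of_length_le (by simp)]

theorem rtake_values [NeZero q] {ord : Fin G.size ≃ G.V} (hord : G.IsTopologicalOrder ord)
    (x : Fin n → Fin q) :
    (List.ofFn x ++ List.ofFn fun k => G.value x (ord k)).rtake m = List.ofFn (G.eval x) := by
  have hm : m ≤ G.size :=
    (Fintype.card_fin m).symm.le.trans (Fintype.card_le_of_injective G.out G.out_injective)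
  rw [List.rtake.eq_1]
  refine List.ext_getElem (by simp; omega) fun j h₁ h₂ => ?_
  have hj : j < m := by simpa using h₂
  have hout : (ord.symm (G.out ⟨j, hj⟩) : ℕ) + m = G.size + j := hord.2 ⟨j, hj⟩
  rw [List.getElem_drop, List.getElem_append_right (by simp; omega), List.getElem_ofFn,
    List.getElem_ofFn, eval]
  congr 1
  rw [← ord.eq_symm_apply]
  apply Fin.ext
  simp
  omega

end CompGraph

/-- Since the alphabet is fixed and the fan-in is bounded, the local functions have constant-size
value tables, so a lookup network implements them exactly and constant precision suffices; the
approximating networks of `happrox` are not needed. -/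
theorem mainTheorem2 (q : ℕ) [NeZero q] (m : ℕ → ℕ) (G : ∀ n, CompGraph q n (m n))
    (hsize : IsPolyBounded fun n => (G n).size)
    (happrox : PolyEfficientlyApproximated G) (hfan : BoundedFanIn G) :
    ∃ p P : ℕ → ℕ, IsLogBounded p ∧ IsPolyBounded P ∧
      ∀ n, 1 ≤ n → ∃ M : Transformer q (p n),
        M.numParams (n + (G n).size) ≤ P n ∧
        ∃ ord : Fin (G n).size ≃ (G n).V, (G n).IsTopologicalOrder ord ∧
          ∀ x : Fin n → Fin q,
            M.cot (List.ofFn x) (G n).size =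
              List.ofFn x ++ List.ofFn (fun k => (G n).value x (ord k)) ∧
            (M.cot (List.ofFn x) (G n).size).rtake (m n) = List.ofFn ((G n).eval x) := by
  obtain ⟨k, hk⟩ := hfan
  -- With `K = k + 1`, the inequality `x < 2 ^ x` at `x = 2 * K + 4` yields the precision required
  -- by the lookup transformer.
  refine ⟨fun _ => 2 * (k + 1) + 4, fun n => lookupSize (n + (G n).size) q (k + 1),
    ⟨2 * (k + 1) + 4, fun n _ => Nat.le_mul_of_pos_right _ (Nat.succ_pos _)⟩,
    (IsPolyBounded.id.add hsize).lookupSize q (k + 1), fun n hn => ?_⟩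
  obtain ⟨ord, hord⟩ := (G n).exists_isTopologicalOrder
  choose τ g hτ hg using
    (G n).exists_lookup (K := k + 1) (fun v => Nat.succ_le_succ (hk n hn v)) hord
  have hprec : 2 * ((k + 1 : ℕ) : ℤ) + 3 ≤ 2 ^ (2 * (k + 1) + 4) - 1 := by
    have : 2 * (k + 1) + 4 < 2 ^ (2 * (k + 1) + 4) := Nat.lt_two_pow_self
    zify at this
    push_cast
    linarith
  obtain ⟨M, hsizeM, hM⟩ := exists_lookupTransformer (by omega) hprec τ g hτ
  have hcot := fun x => (G n).cot_eq_trace M ord x fun t => by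
    have ht := t.isLt
    -- The prefix of length `n + t` ends at position `n + t - 1`, which exists also for `t = 0`
    -- since `n ≥ 1`.
    rw [hM _ ⟨n + t - 1, by omega⟩ (by simp; omega), ← hg ⟨n + t - 1, by omega⟩ x t (by simp; omega)]
    congr 1
    funext h
    simp
  exact ⟨M, hsizeM.le, ord, hord, fun x => ⟨hcot x, by rw [hcot, (G n).rtake_values hord]⟩⟩
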